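/- Let $\mathcal D$ be a probability distribution on $\mathbb R^d\times\{1,\dots,K\}$ with $\|\mathbf x\|_2\le R$ almost surely. Let $S^{(1)},S^{(2)}$ be independent samples, each consisting of finitely many (a fixed number of) i.i.d. draws from $\mathcal D$, and let $W^{(1)},W^{(2)}\in\mathbb R^{K\times d}$ be random matrices, where $W^{(j)}$ is trained on $S^{(j)}$ in an arbitrary, possibly randomized way; write $\mathbf w^{(j)}_i$ for the $i$-th row of $W^{(j)}$. Let $h_j(\mathbf x)=\operatorname{argmax}_{1\le i\le K}\langle \mathbf w^{(j)}_i,\mathbf x\rangle$ be the corresponding classifier, ties being broken by an arbitrary fixed rule. A vector $\mathbf u$ is an adversarial direction for $h$ at $(\mathbf x,y)$ if $h(\mathbf x)=y$ and $h(\mathbf x+c\mathbf u)\ne y$ for some $c>0$. For labels $k,l$ and a set or sample $S$ let $S[k,l]$ be its part with labels in $\{k,l\}$; cardinalities of (parts of) the samples are counted with multiplicity. Fix labels $k,l$, an integer $n\ge1$ and $\rho\in[0,1)$. Suppose that the event $E=\{|S^{(1)}[k,l]|=|S^{(2)}[k,l]|=n\}$ has positive probability, and that 1. almost surely $\|\mathbf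 w^{(j)}_i\|_2\le B$ for all $i\in\{1,\dots,K\}$ and $j\in\{1,2\}$; 2. $(S^{(1)},W^{(1)})$ is independent of $S^{(2)}$, and $(S^{(2)},W^{(2)})$ is independent of $S^{(1)}$; 3. almost surely on $E$, for each $j\in\{1,2\}$, at least a $(1-\rho)$ fraction of the points $(\mathbf x,y)$ of $S^{(j)}[k,l]$ satisfy $h_j(\mathbf x)=y$ and $|\langle \mathbf w^{(j)}_k,\mathbf x\rangle-\langle \mathbf w^{(j)}_l,\mathbf x\rangle|>1$. Then, conditionally on $E$, with probability at least $1-4n^{-2}$ there are a vector $\mathbf v\in\mathbb R^d$ and a set $S\subseteq S^{(1)}[k,l]\cup S^{(2)}[k,l]$ such that for each $j\in\{1,2\}$: (a) $|S\cap S^{(j)}[k,l]|\ \ge\ (1-2\rho)n-4BR\sqrt n-4\sqrt{n\ln n}$; (b) for every $(\mathbf x,y)\in S$ with $h_j(\mathbf x)=y$, the vector $-\mathbf v$ (if $y=k$), respectively $\mathbf v$ (if $y=l$), is an adversarial direction for $h_j$ at $(\mathbf x,y)$. -/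

import Mathlib

open MeasureTheory ProbabilityTheory

/-- A labelled data point `(x, y)` with `x ∈ ℝ^d` (Euclidean norm) and one of `K` labels `y`. -/
abbrev LabeledPoint (d K : ℕ) : Type := EuclideanSpace ℝ (Fin d) × Fin K

/-- `g` is an argmax map: `g z` is an index of a largest entry of `z`
(ties are resolved by `g` in some way that we do not restrict). -/
def IsArgmaxRule {K : ℕ} (g : (Fin K → ℝ) → Fin K) : Prop :=
  ∀ (z : Fin K → ℝ) (i : Fin K), z i ≤ z (g z)

/-- The multi-class linear classifier `x ↦ argmax_i ⟪W i, x⟫`, where `W i` is the `i`-th row of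
the weight matrix `W` and `g` is the argmax map in use. -/
noncomputable def linearClassifier {d K : ℕ} (g : (Fin K → ℝ) → Fin K)
    (W : Fin K → EuclideanSpace ℝ (Fin d)) (x : EuclideanSpace ℝ (Fin d)) : Fin K :=
  g (fun i => inner ℝ (W i) x)

/-- `v` is an adversarial direction for the classifier `h` at `(x, y)`. -/
def IsAdversarialDirection {d K : ℕ} (h : EuclideanSpace ℝ (Fin d) → Fin K)
    (v x : EuclideanSpace ℝ (Fin d)) (y : Fin K) : Prop :=
  h x = y ∧ ∃ c : ℝ, 0 < c ∧ h (x + c • v) ≠ y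

/-- `S[k, l]`: the points of `S` whose label is `k` or `l`. -/
def withLabels {d K : ℕ} (S : Set (LabeledPoint d K)) (k l : Fin K) : Set (LabeledPoint d K) :=
  {p | p ∈ S ∧ (p.2 = k ∨ p.2 = l)}

/-- The number of points of the sample `s` that lie in `A`, counted with multiplicity. -/
noncomputable def sampleCount {d K N : ℕ} (s : Fin N → LabeledPoint d K)
    (A : Set (LabeledPoint d K)) : ℕ :=
  {i : Fin N | s i ∈ A}.ncard

/-- The points `(x, y)` with label `k` or `l` that the classifier with weights `W` labels
correctly and on which its scores for `k` and `l` differ by more than `1`. -/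
def confidentPoints {d K : ℕ} (g : (Fin K → ℝ) → Fin K)
    (W : Fin K → EuclideanSpace ℝ (Fin d)) (k l : Fin K) : Set (LabeledPoint d K) :=
  {p | p ∈ withLabels Set.univ k l ∧ linearClassifier g W p.1 = p.2 ∧
    1 < |inner ℝ (W k) p.1 - inner ℝ (W l) p.1|}

/-- The event that each of the two samples has exactly `n` points with label `k` or `l`. -/
def equalCountEvent {Ω : Type*} {d K : ℕ} {N : Fin 2 → ℕ}
    (X : (j : Fin 2) → Ω → Fin (N j) → LabeledPoint d K) (k l : Fin K) (n : ℕ) : Set Ω :=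
  {ω | ∀ j : Fin 2, sampleCount (X j ω) (withLabels Set.univ k l) = n}

/-! ### Concentration on the Boolean cube. -/

theorem sum_boolVec_succ {M : Type*} [AddCommMonoid M] {n : ℕ} (F : (Fin (n + 1) → Bool) → M) :
    ∑ ε, F ε = ∑ ε : Fin n → Bool, (F (Fin.cons true ε) + F (Fin.cons false ε)) := by
  rw [← (Fin.consEquiv (fun _ : Fin (n + 1) => Bool)).sum_comp F, Fintype.sum_prod_type]
  simp [Fin.consEquiv, Finset.sum_add_distrib]

/-- McDiarmid's inequality on the Boolean cube, in exponential form. -/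
theorem sum_exp_le_of_bounded_differences {n : ℕ} (F : (Fin n → Bool) → ℝ) (c r : ℝ)
    (h : ∀ ε i, |F (Function.update ε i true) - F (Function.update ε i false)| ≤ c) :
    ∑ ε, Real.exp (r * F ε) ≤
      2 ^ n * Real.exp (r * ((∑ ε, F ε) / 2 ^ n) + n * (r ^ 2 * c ^ 2 / 8)) := by
  induction n with
  | zero => simp
  | succ n ih =>
    -- Averaging out the first coordinate preserves bounded differences, so the induction hypothesis
    -- applies to `G`.
    set G : (Fin n → Bool) → ℝ := fun ε => (F (Fin.cons true ε) + F (Fin.cons false ε)) / 2 with hG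
    have hGd : ∀ ε i, |G (Function.update ε i true) - G (Function.update ε i false)| ≤ c := by
      intro ε i
      have h1 := h (Fin.cons true ε) i.succ
      have h2 := h (Fin.cons false ε) i.succ
      simp only [← Fin.cons_update] at h1 h2
      rw [abs_le] at *
      simp only [hG]
      constructor <;> linarith [h1.1, h1.2, h2.1, h2.2]
    have key : ∀ ε : Fin n → Bool,
        Real.exp (r * F (Fin.cons true ε)) + Real.exp (r * F (Fin.cons false ε)) ≤
          2 * Real.exp (r ^ 2 * c ^ 2 / 8) * Real.exp (r * G ε) := by
      intro ε
      set x := F (Fin.cons true ε)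
      set y := F (Fin.cons false ε)
      have hd : |x - y| ≤ c := by
        have := h (Fin.cons true ε) 0
        simpa [Fin.update_cons_zero] using this
      have hsq : (x - y) ^ 2 ≤ c ^ 2 := sq_le_sq' (by linarith [abs_le.1 hd]) (abs_le.1 hd).2
      have e1 : Real.exp (r * x) + Real.exp (r * y) =
          2 * Real.cosh (r * (x - y) / 2) * Real.exp (r * ((x + y) / 2)) := by
        rw [Real.cosh_eq, mul_div_cancel₀ _ (two_ne_zero), add_mul, ← Real.exp_add, ← Real.exp_add]
        ring_nf
      rw [e1]
      have e2 : Real.cosh (r * (x - y) / 2) ≤ Real.exp (r ^ 2 * c ^ 2 / 8) := by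
        refine (Real.cosh_le_exp_half_sq _).trans (Real.exp_le_exp.2 ?_)
        nlinarith [mul_le_mul_of_nonneg_left hsq (sq_nonneg r)]
      gcongr
    rw [sum_boolVec_succ]
    calc _ ≤ ∑ ε : Fin n → Bool, 2 * Real.exp (r ^ 2 * c ^ 2 / 8) * Real.exp (r * G ε) :=
          Finset.sum_le_sum fun ε _ => key ε
      _ ≤ 2 * Real.exp (r ^ 2 * c ^ 2 / 8) *
            (2 ^ n * Real.exp (r * ((∑ ε, G ε) / 2 ^ n) + n * (r ^ 2 * c ^ 2 / 8))) := by
          rw [← Finset.mul_sum]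
          gcongr
          exact ih G hGd
      _ = _ := by
          have : (∑ ε, F ε) / 2 ^ (n + 1) = (∑ ε, G ε) / 2 ^ n := by
            rw [sum_boolVec_succ, ← Finset.sum_div, pow_succ]
            field_simp
          rw [this, mul_mul_mul_comm, ← Real.exp_add]
          push_cast
          rw [pow_succ]
          ring_nf

theorem card_boolVec_ge_le {n : ℕ} (hn : 0 < n) (F : (Fin n → Bool) → ℝ) {c m s : ℝ} (hc : 0 < c)
    (hs : 0 ≤ s)
    (h : ∀ ε i, |F (Function.update ε i true) - F (Function.update ε i false)| ≤ c)
    (hm : ∑ ε, F ε ≤ 2 ^ n * m) (A : Finset (Fin n → Bool)) (hA : ∀ ε ∈ A, m + s ≤ F ε) :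
    (A.card : ℝ) ≤ 2 ^ n * Real.exp (-(2 * s ^ 2 / (n * c ^ 2))) := by
  have hn' : (0 : ℝ) < n := by exact_mod_cast hn
  -- The Chernoff parameter minimising `-r * s + n * r² * c² / 8`.
  set r := 4 * s / (n * c ^ 2) with hr
  have hr0 : 0 ≤ r := by positivity
  have h1 : (A.card : ℝ) * Real.exp (r * (m + s)) ≤
      2 ^ n * Real.exp (r * m + n * (r ^ 2 * c ^ 2 / 8)) := by
    calc (A.card : ℝ) * Real.exp (r * (m + s)) = ∑ _ε ∈ A, Real.exp (r * (m + s)) := by simp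
      _ ≤ ∑ ε ∈ A, Real.exp (r * F ε) := by
          refine Finset.sum_le_sum fun ε hε => Real.exp_le_exp.2 ?_
          exact mul_le_mul_of_nonneg_left (hA ε hε) hr0
      _ ≤ ∑ ε, Real.exp (r * F ε) :=
          Finset.sum_le_sum_of_subset_of_nonneg (Finset.subset_univ _)
            fun _ _ _ => (Real.exp_pos _).le
      _ ≤ _ := sum_exp_le_of_bounded_differences F c r h
      _ ≤ _ := by
          have : (∑ ε, F ε) / 2 ^ n ≤ m := by
            rw [div_le_iff₀ (by positivity)]
            linarith
          gcongr
  have h2 : 2 ^ n * Real.exp (r * m + n * (r ^ 2 * c ^ 2 / 8)) =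
      2 ^ n * Real.exp (-(2 * s ^ 2 / (n * c ^ 2))) * Real.exp (r * (m + s)) := by
    rw [mul_assoc, ← Real.exp_add]
    congr 2
    rw [hr]
    field_simp
    ring
  rw [h2] at h1
  exact le_of_mul_le_mul_right h1 (Real.exp_pos _)

/-! ### Contraction for Rademacher suprema. -/

/-- The sign `±1` encoded by a Boolean. -/
def boolSign (b : Bool) : ℝ := if b then -1 else 1

/-- Let `s`, `t` attain the suprema on the left. Since `f t - f s ≤ |g t - g s|`, placing `s` and
`t` in the two suprema on the right, in the order given by the sign of `g t - g s`, does at least as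
well. -/
theorem sup'_add_sup'_sub_le {T : Type*} [Fintype T] [Nonempty T] (a f g : T → ℝ)
    (h : ∀ s t, |f s - f t| ≤ |g s - g t|) :
    Finset.univ.sup' Finset.univ_nonempty (fun t => a t - f t) +
        Finset.univ.sup' Finset.univ_nonempty (fun t => a t + f t) ≤
      Finset.univ.sup' Finset.univ_nonempty (fun t => a t - g t) +
        Finset.univ.sup' Finset.univ_nonempty (fun t => a t + g t) := by
  obtain ⟨s, -, hs⟩ := Finset.exists_mem_eq_sup' Finset.univ_nonempty (fun t => a t - f t)
  obtain ⟨t, -, ht⟩ := Finset.exists_mem_eq_sup' Finset.univ_nonempty (fun t => a t + f t)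
  rw [hs, ht]
  have h1 := Finset.le_sup' (fun t => a t - g t) (Finset.mem_univ s)
  have h2 := Finset.le_sup' (fun t => a t + g t) (Finset.mem_univ s)
  have h3 := Finset.le_sup' (fun t => a t - g t) (Finset.mem_univ t)
  have h4 := Finset.le_sup' (fun t => a t + g t) (Finset.mem_univ t)
  have h5 := h t s
  have h6 := le_abs_self (f t - f s)
  rcases abs_cases (g t - g s) with ⟨e, -⟩ | ⟨e, -⟩ <;> linarith

/-- The contraction principle for Rademacher averages. -/
theorem sum_sup'_signed_le {T : Type*} [Fintype T] [Nonempty T] {n : ℕ} (f g : Fin n → T → ℝ)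
    (h : ∀ i s t, |f i s - f i t| ≤ |g i s - g i t|) (a : T → ℝ) :
    ∑ ε : Fin n → Bool, Finset.univ.sup' Finset.univ_nonempty
        (fun t => a t + ∑ i, boolSign (ε i) * f i t) ≤
      ∑ ε : Fin n → Bool, Finset.univ.sup' Finset.univ_nonempty
        (fun t => a t + ∑ i, boolSign (ε i) * g i t) := by
  induction n generalizing a with
  | zero => simp
  | succ n ih =>
    rw [sum_boolVec_succ, sum_boolVec_succ]
    simp only [Fin.sum_univ_succ, Fin.cons_zero, Fin.cons_succ]
    -- The offset absorbs the first coordinate, already changed to `g 0`; `i3` makes that change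
    -- while the later coordinates are still `f`.
    have i1 := ih (fun i => f i.succ) (fun i => g i.succ) (fun i => h i.succ) (fun t => a t - g 0 t)
    have i2 := ih (fun i => f i.succ) (fun i => g i.succ) (fun i => h i.succ) (fun t => a t + g 0 t)
    have i3 := Finset.sum_le_sum fun (ε : Fin n → Bool) (_ : ε ∈ Finset.univ) =>
      sup'_add_sup'_sub_le (fun t => a t + ∑ i, boolSign (ε i) * f i.succ t) (f 0) (g 0) (h 0)
    simp only [Finset.sum_add_distrib] at i3 ⊢
    simp only [boolSign, if_true, Bool.false_eq_true, if_false, neg_mul, one_mul] at i1 i2 i3 ⊢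
    have e1 : ∀ x y z : ℝ, x + (-y + z) = x + z - y := by intros; ring
    have e2 : ∀ x y z : ℝ, x + (y + z) = x + z + y := by intros; ring
    have e3 : ∀ x y z : ℝ, x - y + z = x + z - y := by intros; ring
    have e4 : ∀ x y z : ℝ, x + y + z = x + z + y := by intros; ring
    simp only [e3] at i1
    simp only [e4 _ (g 0 _) _] at i2
    simp only [e1, e2]
    linarith

/-! ### Random signs and clipped margins in an inner product space. -/

section Euclidean

variable {E : Type*} [NormedAddCommGroup E] [InnerProductSpace ℝ E]

theorem sum_norm_sq_signed {n : ℕ} (x : Fin n → E) (y : E) :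
    ∑ ε : Fin n → Bool, ‖y + ∑ i, boolSign (ε i) • x i‖ ^ 2 = 2 ^ n * (‖y‖ ^ 2 + ∑ i, ‖x i‖ ^ 2) := by
  induction n generalizing y with
  | zero => simp
  | succ n ih =>
    rw [sum_boolVec_succ, Finset.sum_add_distrib]
    simp only [Fin.sum_univ_succ, Fin.cons_zero, Fin.cons_succ, ← add_assoc]
    rw [ih (fun i => x i.succ), ih (fun i => x i.succ)]
    have := parallelogram_law_with_norm ℝ y (x 0)
    simp only [boolSign, if_true, Bool.false_eq_true, if_false, neg_smul, one_smul,
      ← sub_eq_add_neg, pow_succ (2 : ℝ) n]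
    linear_combination (2 : ℝ) ^ n * this

/-- Cauchy–Schwarz over the sign vectors reduces this to the mean square. -/
theorem sum_norm_signed_le {n : ℕ} (x : Fin n → E) {R : ℝ} (hR : 0 ≤ R) (hx : ∀ i, ‖x i‖ ≤ R) :
    ∑ ε : Fin n → Bool, ‖∑ i, boolSign (ε i) • x i‖ ≤ 2 ^ n * (R * √n) := by
  have h1 := sum_norm_sq_signed x 0
  simp only [zero_add, norm_zero] at h1
  have h2 := sq_sum_le_card_mul_sum_sq (s := (Finset.univ : Finset (Fin n → Bool)))
    (f := fun ε => ‖∑ i, boolSign (ε i) • x i‖)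
  have h3 : ∑ i, ‖x i‖ ^ 2 ≤ n * R ^ 2 := by
    calc _ ≤ ∑ _i : Fin n, R ^ 2 := by
          gcongr with i
          exact hx i
      _ = _ := by simp
  refine abs_le_of_sq_le_sq' ?_ (by positivity) |>.2
  refine h2.trans ?_
  rw [h1]
  simp only [Finset.card_univ, Fintype.card_fun, Fintype.card_bool, Fintype.card_fin, mul_pow,
    Real.sq_sqrt (Nat.cast_nonneg n)]
  push_cast
  have : (0 : ℝ) ≤ 2 ^ n * 2 ^ n := by positivity
  nlinarith

/-- Truncation of a real number to `[-1, 1]`. -/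
noncomputable def clipUnit (z : ℝ) : ℝ := max (-1) (min 1 z)

theorem abs_clipUnit_le (z : ℝ) : |clipUnit z| ≤ 1 :=
  abs_le.2 ⟨le_max_left _ _, max_le (by norm_num) (min_le_left _ _)⟩

theorem abs_clipUnit_sub_le (y z : ℝ) : |clipUnit y - clipUnit z| ≤ |y - z| := by
  refine (abs_max_sub_max_le_max _ _ _ _).trans (max_le (by simp) ?_)
  exact (abs_min_sub_min_le_max _ _ _ _).trans (max_le (by simp) le_rfl)

theorem clipUnit_neg (z : ℝ) : clipUnit (-z) = -clipUnit z := by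
  unfold clipUnit
  rcases le_total 1 z with h | h <;> rcases le_total (-1) z with h' | h' <;>
    simp [min_def, max_def] <;> split_ifs <;> linarith

/-- Clipping is 1-Lipschitz, so contraction removes it; the remaining supremum is linear in `u t`,
hence at most `b` times the norm of the signed sum. -/
theorem sum_sup'_clipUnit_le {T : Type*} [Fintype T] [Nonempty T] {n : ℕ} (u : T → E) (x : Fin n → E)
    {b R : ℝ} (hR : 0 ≤ R) (hu : ∀ t, ‖u t‖ ≤ b) (hx : ∀ i, ‖x i‖ ≤ R) :
    ∑ ε : Fin n → Bool, Finset.univ.sup' Finset.univ_nonempty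
        (fun t => ∑ i, boolSign (ε i) * clipUnit (inner ℝ (u t) (x i))) ≤
      2 ^ n * (b * R * √n) := by
  have hb : 0 ≤ b := (norm_nonneg _).trans (hu (Classical.arbitrary T))
  have h1 := sum_sup'_signed_le (fun i t => clipUnit (inner ℝ (u t) (x i)))
    (fun i t => inner ℝ (u t) (x i)) (fun i s t => abs_clipUnit_sub_le _ _) (fun _ => 0)
  simp only [zero_add] at h1
  calc _ ≤ _ := h1
    _ ≤ ∑ ε : Fin n → Bool, b * ‖∑ i, boolSign (ε i) • x i‖ := by
        refine Finset.sum_le_sum fun ε _ => Finset.sup'_le _ _ fun t _ => ?_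
        have : ∑ i, boolSign (ε i) * inner ℝ (u t) (x i) =
            inner ℝ (u t) (∑ i, boolSign (ε i) • x i) := by
          simp [inner_sum, inner_smul_right]
        rw [this]
        exact (real_inner_le_norm _ _).trans (by gcongr; exact hu t)
    _ ≤ b * (2 ^ n * (R * √n)) := by
        rw [← Finset.mul_sum]
        gcongr
        exact sum_norm_signed_le x hR hx
    _ = _ := by ring

/-- Some vector of norm at most `b` separates most of the first points from most of the second
ones with margin `1`. -/
def MostlySeparated {n : ℕ} (b c : ℝ) (a : Fin n → Bool → E) : Prop :=
  ∃ u : E, ‖u‖ ≤ b ∧ c ≤ ({i | 1 < inner ℝ u (a i false)} : Set (Fin n)).ncard ∧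
    c ≤ ({i | 1 < inner ℝ (-u) (a i true)} : Set (Fin n)).ncard

/-- A term is `1` when `z i > 1` and at least `-1` otherwise. -/
theorem two_mul_ncard_sub_le_sum_clipUnit {n : ℕ} (z : Fin n → ℝ) :
    2 * ({i | 1 < z i} : Set (Fin n)).ncard - (n : ℝ) ≤ ∑ i, clipUnit (z i) := by
  classical
  rw [Set.ncard_eq_toFinset_card', Set.toFinset_ofPred, Finset.card_filter]
  push_cast
  have : (n : ℝ) = ∑ _i : Fin n, (1 : ℝ) := by simp
  rw [this, Finset.mul_sum, ← Finset.sum_sub_distrib]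
  refine Finset.sum_le_sum fun i _ => ?_
  split_ifs with h
  · simp only [clipUnit]
    rw [min_eq_left h.le]
    norm_num
  · have := (abs_le.1 (abs_clipUnit_le (z i))).1
    linarith

/-- Choosing one separator `u ε` per `ε ∈ A` makes the supremum a finite maximum indexed by `A`
itself. At each point of `A` it is far above its mean. -/
theorem card_mostlySeparated_le {n : ℕ} (hn : 1 ≤ n) {b ρ R : ℝ} (hR : 0 ≤ R)
    (a : Fin n → Bool → E) (ha : ∀ i j, ‖a i j‖ ≤ R)
    (h : 2 * b * R * √n + 4 * √(n * Real.log n) ≤ (1 - 2 * ρ) * n)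
    (A : Finset (Fin n → Bool))
    (hA : ∀ ε ∈ A, MostlySeparated b ((1 - ρ) * n) (fun i j => a i (xor j (ε i)))) :
    (A.card : ℝ) ≤ 2 ^ n * (4 / (n : ℝ) ^ 2) := by
  have hn' : (1 : ℝ) ≤ n := by exact_mod_cast hn
  rcases A.eq_empty_or_nonempty with rfl | hne
  · simp only [Finset.card_empty, Nat.cast_zero]
    positivity
  have : Nonempty A := hne.to_subtype
  choose! u hub hu1 hu2 using hA
  set f : Fin n → A → ℝ := fun i t =>
    clipUnit (inner ℝ (u t) (a i false)) - clipUnit (inner ℝ (u t) (a i true)) with hf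
  set F : (Fin n → Bool) → ℝ := fun ε => Finset.univ.sup' Finset.univ_nonempty
    (fun t : A => ∑ i, boolSign (ε i) * f i t) with hF
  have hb : 0 ≤ b := by
    obtain ⟨ε, hε⟩ := hne
    exact (norm_nonneg _).trans (hub ε hε)
  have hf2 : ∀ i t, |f i t| ≤ 2 := fun i t => by
    have h1 := abs_le.1 (abs_clipUnit_le (inner ℝ (u t) (a i false)))
    have h2 := abs_le.1 (abs_clipUnit_le (inner ℝ (u t) (a i true)))
    exact abs_le.2 ⟨by simp only [hf]; linarith, by simp only [hf]; linarith⟩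
  -- Flipping one sign moves a term bounded by `2` by at most `4`.
  have hstep : ∀ ε i b b', F (Function.update ε i b) - F (Function.update ε i b') ≤ 4 := by
    intro ε i b b'
    rw [sub_le_iff_le_add]
    refine Finset.sup'_le _ _ fun t _ => ?_
    have h1 := Finset.le_sup' (fun t : A => ∑ j, boolSign (Function.update ε i b' j) * f j t)
      (Finset.mem_univ t)
    refine le_trans ?_ (add_le_add_right h1 4)
    rw [← Finset.add_sum_erase _ _ (Finset.mem_univ i)]
    rw [← Finset.add_sum_erase (Finset.univ) (fun j => boolSign (Function.update ε i b' j) * f j t)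
      (Finset.mem_univ i)]
    have : ∀ c, ∑ j ∈ Finset.univ.erase i, boolSign (Function.update ε i c j) * f j t =
        ∑ j ∈ Finset.univ.erase i, boolSign (ε j) * f j t := fun c =>
      Finset.sum_congr rfl fun j hj => by
        rw [Function.update_of_ne (Finset.ne_of_mem_erase hj)]
    rw [this, this]
    have h2 := abs_le.1 (hf2 i t)
    simp only [Function.update_self]
    cases b <;> cases b' <;> simp [boolSign] <;> linarith
  have hmean : ∑ ε, F ε ≤ 2 ^ n * (2 * b * R * √n) := by
    have h1 := sum_sup'_clipUnit_le (fun t : A => u t) (fun i => a i false) hR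
      (fun t => hub t t.2) (fun i => ha i _)
    have h2 := sum_sup'_clipUnit_le (fun t : A => -u t) (fun i => a i true) hR
      (fun t => by rw [norm_neg]; exact hub t t.2) (fun i => ha i _)
    have h3 : ∑ ε, F ε ≤ _ := (Finset.sum_le_sum fun ε _ => ?_).trans
      (Finset.sum_add_distrib.trans_le (add_le_add h1 h2))
    · refine h3.trans_eq (by ring)
    · refine Finset.sup'_le _ _ fun t _ => ?_
      have h4 := Finset.le_sup' (fun t : A => ∑ i, boolSign (ε i) *
        clipUnit (inner ℝ (u t) (a i false))) (Finset.mem_univ t)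
      have h5 := Finset.le_sup' (fun t : A => ∑ i, boolSign (ε i) *
        clipUnit (inner ℝ (-u t) (a i true))) (Finset.mem_univ t)
      refine le_trans (le_of_eq ?_) (add_le_add h4 h5)
      simp only [hf, inner_neg_left, clipUnit_neg, mul_sub, mul_neg, Finset.sum_sub_distrib,
        Finset.sum_neg_distrib]
      ring
  -- The index `t = ε` suffices: the sign undoes the swap, so both clipped sums are at least
  -- `(1-2ρ)n`, and `h` is used twice.
  have hlarge : ∀ ε ∈ A, 2 * b * R * √n + 8 * √(n * Real.log n) ≤ F ε := by
    intro ε hε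
    have h1 := hu1 ε hε
    have h2 := hu2 ε hε
    have h3 := two_mul_ncard_sub_le_sum_clipUnit (fun i => inner ℝ (u ε) (a i (xor false (ε i))))
    have h4 := two_mul_ncard_sub_le_sum_clipUnit (fun i => inner ℝ (-u ε) (a i (xor true (ε i))))
    have h5 := Finset.le_sup' (fun t : A => ∑ i, boolSign (ε i) * f i t)
      (Finset.mem_univ (⟨ε, hε⟩ : A))
    have h6 : ∑ i, boolSign (ε i) * f i ⟨ε, hε⟩ =
        ∑ i, clipUnit (inner ℝ (u ε) (a i (xor false (ε i)))) +
          ∑ i, clipUnit (inner ℝ (-u ε) (a i (xor true (ε i)))) := by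
      rw [← Finset.sum_add_distrib]
      refine Finset.sum_congr rfl fun i _ => ?_
      simp only [hf, inner_neg_left, clipUnit_neg]
      cases ε i <;> simp [boolSign] <;> ring
    have h7 : 0 ≤ 2 * b * R * √n := by positivity
    simp only [hF]
    linarith
  have hlog : 0 ≤ Real.log n := Real.log_nonneg hn'
  refine (card_boolVec_ge_le hn F (c := 4) (by norm_num) (s := 8 * √(n * Real.log n))
    (by positivity) (fun ε i => abs_le.2 ⟨?_, hstep ε i _ _⟩) hmean A hlarge).trans ?_
  · linarith [hstep ε i false true]
  · gcongr
    rw [mul_pow, Real.sq_sqrt (by positivity)]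
    -- The tail is `n⁻⁸`, below `4 / n²`.
    have : -(2 * (8 ^ 2 * (n * Real.log n)) / (n * 4 ^ 2)) = -(8 * Real.log n) := by
      field_simp
      ring
    rw [this, le_div_iff₀ (by positivity)]
    have h8 : (n : ℝ) ^ 2 = Real.exp (2 * Real.log n) := by
      rw [two_mul, Real.exp_add, Real.exp_log (by positivity), sq]
    rw [h8, ← Real.exp_add]
    refine le_trans (Real.exp_le_one_iff.2 ?_) (by norm_num)
    linarith

end Euclidean

/-! ### Measurability of separation and symmetrization by pair swaps. -/

theorem isOpen_setOf_le_ncard {Y : Type*} [TopologicalSpace Y] {n : ℕ} {U : Fin n → Set Y}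
    (hU : ∀ i, IsOpen (U i)) (c : ℝ) :
    IsOpen {x | c ≤ ({i | x ∈ U i} : Set (Fin n)).ncard} := by
  refine isOpen_iff_mem_nhds.2 fun x hx => ?_
  have h : ∀ᶠ y in nhds x, ∀ i, x ∈ U i → y ∈ U i :=
    Filter.eventually_all.2 fun i => by
      by_cases hi : x ∈ U i
      · filter_upwards [(hU i).mem_nhds hi] with y hy _ using hy
      · exact Filter.Eventually.of_forall fun y h => absurd h hi
  filter_upwards [h] with y hy
  refine le_trans (show c ≤ _ from hx) ?_
  exact_mod_cast Set.ncard_le_ncard (fun i hi => hy i hi) (Set.toFinite _)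

/-- For fixed `u` the conditions are open, and any union of open sets is open; the uncountable
choice of `u` thus costs no measurability. -/
theorem isOpen_setOf_mostlySeparated {E : Type*} [NormedAddCommGroup E] [InnerProductSpace ℝ E]
    (n : ℕ) (b c : ℝ) : IsOpen {a : Fin n → Bool → E | MostlySeparated b c a} := by
  have : {a : Fin n → Bool → E | MostlySeparated b c a} = ⋃ u : {u : E // ‖u‖ ≤ b},
      {a | c ≤ ({i | a ∈ {a' : Fin n → Bool → E | 1 < inner ℝ (u : E) (a' i false)}} :
          Set (Fin n)).ncard} ∩
        {a | c ≤ ({i | a ∈ {a' : Fin n → Bool → E | 1 < inner ℝ (-u : E) (a' i true)}} :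
          Set (Fin n)).ncard} := by
    ext a
    simp only [MostlySeparated, Set.mem_ofPred_eq, Set.mem_iUnion, Set.mem_inter_iff,
      Subtype.exists, exists_prop]
  rw [this]
  refine isOpen_iUnion fun u => IsOpen.inter ?_ ?_
  · exact isOpen_setOf_le_ncard (fun i => isOpen_lt continuous_const (by fun_prop)) c
  · exact isOpen_setOf_le_ncard (fun i => isOpen_lt continuous_const (by fun_prop)) c

/-- The permutation of `Fin n × Bool` swapping `(i, false)` and `(i, true)` whenever `ε i`. -/
def pairSwap {n : ℕ} (ε : Fin n → Bool) : Equiv.Perm (Fin n × Bool) where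
  toFun p := (p.1, xor p.2 (ε p.1))
  invFun p := (p.1, xor p.2 (ε p.1))
  left_inv p := by simp
  right_inv p := by simp

theorem measurePreserving_comp_perm {ι Z : Type*} [Fintype ι] [MeasurableSpace Z] (D : Measure Z)
    [IsProbabilityMeasure D] (σ : Equiv.Perm ι) :
    MeasurePreserving (fun s : ι → Z => s ∘ σ) (Measure.pi fun _ => D) (Measure.pi fun _ => D) :=
  measurePreserving_arrowCongr' (fun _ : ι => D) (fun _ : ι => D) σ.symm (MeasurableEquiv.refl Z)
    fun _ => MeasurePreserving.id D

open Classical in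
/-- Symmetrization: if, for almost every sample, at most a fraction `p` of the swaps of paired
coordinates leads into `H`, then `H` has conditional probability at most `p` given a set `G` that is
invariant under such swaps. -/
theorem measure_inter_le_of_pairSwap {ι Z : Type*} [Fintype ι] [MeasurableSpace Z] (D : Measure Z)
    [IsProbabilityMeasure D] {n : ℕ} (e : Fin n × Bool ↪ ι) {G : Set (ι → Z)}
    (hG : MeasurableSet G) (hGinv : ∀ ε s, s ∘ (pairSwap ε).viaEmbedding e ∈ G ↔ s ∈ G)
    {H : Set (Fin n → Bool → Z)} (hH : MeasurableSet H) (p : ℝ)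
    (hp : ∀ᵐ s ∂(Measure.pi fun _ : ι => D),
      (({ε : Fin n → Bool | (fun i j => s (e (i, xor j (ε i)))) ∈ H} : Finset _).card : ℝ) ≤
        2 ^ n * p) :
    Measure.pi (fun _ : ι => D) (G ∩ {s | (fun i j => s (e (i, j))) ∈ H}) ≤
      ENNReal.ofReal p * Measure.pi (fun _ : ι => D) G := by
  set P := Measure.pi fun _ : ι => D
  set Hε : (Fin n → Bool) → Set (ι → Z) := fun ε => {s | (fun i j => s (e (i, xor j (ε i)))) ∈ H}
  have hHε : ∀ ε, MeasurableSet (Hε ε) := fun ε => by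
    have : Measurable fun (s : ι → Z) (i : Fin n) (j : Bool) => s (e (i, xor j (ε i))) := by
      fun_prop
    exact this hH
  have hH0 : MeasurableSet {s : ι → Z | (fun i j => s (e (i, j))) ∈ H} := by
    have : Measurable fun (s : ι → Z) (i : Fin n) (j : Bool) => s (e (i, j)) := by fun_prop
    exact this hH
  -- Each swap preserves `P` and `G`, so all `2 ^ n` events have equal measure; summing them under
  -- the integral brings in `hp`.
  have hswap : ∀ ε, P (G ∩ {s | (fun i j => s (e (i, j))) ∈ H}) = P (Hε ε ∩ G) := fun ε => by
    rw [← (measurePreserving_comp_perm D ((pairSwap ε).viaEmbedding e)).measure_preimage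
      (hG.inter hH0).nullMeasurableSet]
    congr 1
    ext s
    rw [Set.mem_preimage, Set.mem_inter_iff, hGinv]
    simp only [Set.mem_inter_iff, Set.mem_ofPred_eq, Function.comp_apply,
      Equiv.Perm.viaEmbedding_apply, pairSwap, Equiv.coe_fn_mk, Hε]
    exact and_comm
  have hsum : (2 : ENNReal) ^ n * P (G ∩ {s | (fun i j => s (e (i, j))) ∈ H}) ≤
      2 ^ n * (ENNReal.ofReal p * P G) := by
    calc (2 : ENNReal) ^ n * P (G ∩ {s | (fun i j => s (e (i, j))) ∈ H})
        = ∑ ε : Fin n → Bool, P (Hε ε ∩ G) := by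
          rw [← Finset.sum_congr rfl fun ε _ => hswap ε]
          simp
      _ = ∫⁻ s in G, ∑ ε : Fin n → Bool, (Hε ε).indicator 1 s ∂P := by
          rw [lintegral_finsetSum _ fun ε _ => measurable_one.indicator (hHε ε)]
          refine Finset.sum_congr rfl fun ε _ => ?_
          rw [lintegral_indicator_one (hHε ε), Measure.restrict_apply (hHε ε)]
      _ ≤ ∫⁻ _ in G, 2 ^ n * ENNReal.ofReal p ∂P := by
          refine lintegral_mono_ae (ae_restrict_of_ae ?_)
          filter_upwards [hp] with s hs
          have h1 := ENNReal.ofReal_le_ofReal hs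
          rw [ENNReal.ofReal_natCast, ENNReal.ofReal_mul (by positivity),
            ENNReal.ofReal_pow (by norm_num), ENNReal.ofReal_ofNat] at h1
          refine le_trans (le_of_eq ?_) h1
          rw [Finset.card_filter]
          simp [Set.indicator_apply, Hε]
      _ = _ := by
          rw [setLIntegral_const, mul_assoc]
  exact (ENNReal.mul_le_mul_iff_right (by positivity) (by finiteness)).1 hsum

/-! ### Opposed samples are improbable. -/

section LinearClassifiers

variable {d K : ℕ}

/-- The input of `p`, with its sign flipped unless the label is `k`. -/
noncomputable def signedInput (k : Fin K) (p : LabeledPoint d K) : EuclideanSpace ℝ (Fin d) :=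
  if p.2 = k then p.1 else -p.1

theorem measurable_signedInput (k : Fin K) :
    Measurable (signedInput k : LabeledPoint d K → EuclideanSpace ℝ (Fin d)) :=
  Measurable.ite (measurable_snd (MeasurableSet.singleton k)) measurable_fst measurable_fst.neg

theorem norm_signedInput (k : Fin K) (p : LabeledPoint d K) : ‖signedInput k p‖ = ‖p.1‖ := by
  unfold signedInput
  split_ifs <;> simp

theorem measurableSet_withLabels_univ (k l : Fin K) :
    MeasurableSet (withLabels (Set.univ : Set (LabeledPoint d K)) k l) := by
  have : withLabels (Set.univ : Set (LabeledPoint d K)) k l = Prod.snd ⁻¹' {k, l} := by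
    ext p; simp [withLabels]
  rw [this]
  exact measurable_snd (Set.toFinite _).measurableSet

/-- The points with label `k` or `l` that `u` separates with margin more than `1`. -/
def marginPoints (u : EuclideanSpace ℝ (Fin d)) (k l : Fin K) : Set (LabeledPoint d K) :=
  {p | p ∈ withLabels Set.univ k l ∧ 1 < inner ℝ u (signedInput k p)}

theorem sampleCount_marginPoints {N n : ℕ} (s : Fin N → LabeledPoint d K) (k l : Fin K)
    (u : EuclideanSpace ℝ (Fin d)) (f : Fin n ↪ Fin N)
    (hf : ∀ i, s i ∈ withLabels Set.univ k l ↔ i ∈ Set.range f) :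
    sampleCount s (marginPoints u k l) =
      ({i | 1 < inner ℝ u (signedInput k (s (f i)))} : Set (Fin n)).ncard := by
  rw [← Set.ncard_image_of_injective _ f.injective, sampleCount]
  congr 1
  ext i
  simp only [marginPoints, Set.mem_ofPred_eq, hf, Set.mem_image, Set.mem_range]
  constructor
  · rintro ⟨⟨j, rfl⟩, h⟩
    exact ⟨j, h, rfl⟩
  · rintro ⟨j, h, rfl⟩
    exact ⟨⟨j, rfl⟩, h⟩

/-- Some vector of norm at most `b` separates at least `c` points of the first sample, while its
negative separates at least `c` points of the second sample. -/
def OpposedSamples {N N' : ℕ} (s : Fin N → LabeledPoint d K) (s' : Fin N' → LabeledPoint d K)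
    (k l : Fin K) (b c : ℝ) : Prop :=
  ∃ u : EuclideanSpace ℝ (Fin d), ‖u‖ ≤ b ∧ c ≤ sampleCount s (marginPoints u k l) ∧
    c ≤ sampleCount s' (marginPoints (-u) k l)

/-- The event splits by the positions `I` of the points labelled `k` or `l`. On each piece the
`i`-th such points of the two samples are paired, and symmetrization applies. -/
theorem measure_opposedSamples_le (D : Measure (LabeledPoint d K)) [IsProbabilityMeasure D]
    {R b ρ : ℝ} (hR : ∀ᵐ p ∂D, ‖p.1‖ ≤ R) (N N' : ℕ) (k l : Fin K) {n : ℕ} (hn : 1 ≤ n)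
    (h : 2 * b * R * √n + 4 * √(n * Real.log n) ≤ (1 - 2 * ρ) * n) :
    Measure.pi (fun _ : Fin N ⊕ Fin N' => D)
        ({s | sampleCount (s ∘ Sum.inl) (withLabels Set.univ k l) = n ∧
            sampleCount (s ∘ Sum.inr) (withLabels Set.univ k l) = n} ∩
          {s | OpposedSamples (s ∘ Sum.inl) (s ∘ Sum.inr) k l b ((1 - ρ) * n)}) ≤
      ENNReal.ofReal (4 / (n : ℝ) ^ 2) * Measure.pi (fun _ : Fin N ⊕ Fin N' => D)
        {s | sampleCount (s ∘ Sum.inl) (withLabels Set.univ k l) = n ∧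
            sampleCount (s ∘ Sum.inr) (withLabels Set.univ k l) = n} := by
  classical
  set P := Measure.pi (fun _ : Fin N ⊕ Fin N' => D)
  set L : Set (LabeledPoint d K) := withLabels Set.univ k l with hL
  have hR0 : 0 ≤ R := by
    obtain ⟨p, hp⟩ := hR.exists
    exact (norm_nonneg _).trans hp
  have hRP : ∀ᵐ s ∂P, ∀ i, ‖(s i).1‖ ≤ R :=
    ae_all_iff.2 fun i => (Measure.quasiMeasurePreserving_eval (μ := fun _ => D) i).ae hR
  let J : Finset (Finset (Fin N) × Finset (Fin N')) := {I | I.1.card = n ∧ I.2.card = n}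
  let C : Finset (Fin N) × Finset (Fin N') → Set (Fin N ⊕ Fin N' → LabeledPoint d K) := fun I =>
    {s | ∀ i, s i ∈ L ↔ Sum.elim (· ∈ I.1) (· ∈ I.2) i}
  have hCmeas : ∀ I, MeasurableSet (C I) := fun I => by
    have : C I = ⋂ i, {s | s i ∈ L ↔ Sum.elim (· ∈ I.1) (· ∈ I.2) i} := by
      ext s; simp [C]
    rw [this]
    refine MeasurableSet.iInter fun i => ?_
    by_cases hi : Sum.elim (· ∈ I.1) (· ∈ I.2) i
    · simp only [hi, iff_true]
      exact measurable_pi_apply (X := fun _ => LabeledPoint d K) i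
        (measurableSet_withLabels_univ k l)
    · simp only [hi, iff_false]
      exact (measurable_pi_apply (X := fun _ => LabeledPoint d K) i
        (measurableSet_withLabels_univ k l)).compl
  have hCdisj : Set.PairwiseDisjoint (J : Set (Finset (Fin N) × Finset (Fin N'))) C := by
    intro I _ I' _ hne
    refine Set.disjoint_left.2 fun s hs hs' => hne ?_
    ext i
    · exact (hs (Sum.inl i)).symm.trans (hs' (Sum.inl i))
    · exact (hs (Sum.inr i)).symm.trans (hs' (Sum.inr i))
  have hE : {s : Fin N ⊕ Fin N' → LabeledPoint d K | sampleCount (s ∘ Sum.inl) L = n ∧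
      sampleCount (s ∘ Sum.inr) L = n} = ⋃ I ∈ J, C I := by
    ext s
    simp only [Set.mem_ofPred_eq, Set.mem_iUnion, exists_prop, J, C, Finset.mem_filter,
      Finset.mem_univ, true_and]
    constructor
    · rintro ⟨h1, h2⟩
      refine ⟨(({i | s (Sum.inl i) ∈ L} : Finset _), ({i | s (Sum.inr i) ∈ L} : Finset _)),
        ⟨?_, ?_⟩, ?_⟩
      · rw [← h1, sampleCount, Set.ncard_eq_toFinset_card', Set.toFinset_ofPred]
        rfl
      · rw [← h2, sampleCount, Set.ncard_eq_toFinset_card', Set.toFinset_ofPred]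
        rfl
      · rintro (i | i) <;> simp
    · rintro ⟨I, ⟨h1, h2⟩, h3⟩
      constructor
      · rw [← h1, ← Set.ncard_coe_finset, sampleCount]
        congr 1
        ext i
        exact h3 (Sum.inl i)
      · rw [← h2, ← Set.ncard_coe_finset, sampleCount]
        congr 1
        ext i
        exact h3 (Sum.inr i)
  have hmain : ∀ I ∈ J, P (C I ∩ {s | OpposedSamples (s ∘ Sum.inl) (s ∘ Sum.inr) k l b
      ((1 - ρ) * n)}) ≤ ENNReal.ofReal (4 / (n : ℝ) ^ 2) * P (C I) := by
    intro I hI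
    obtain ⟨h1, h2⟩ : I.1.card = n ∧ I.2.card = n := by simpa [J] using hI
    let e0 : Fin n ↪ Fin N := (I.1.orderEmbOfFin h1).toEmbedding
    let e1 : Fin n ↪ Fin N' := (I.2.orderEmbOfFin h2).toEmbedding
    have hr0 : ∀ i, i ∈ Set.range e0 ↔ i ∈ I.1 := fun i => by
      simp [e0]
    have hr1 : ∀ i, i ∈ Set.range e1 ↔ i ∈ I.2 := fun i => by
      simp [e1]
    let e : Fin n × Bool ↪ Fin N ⊕ Fin N' :=
      ⟨fun p => bif p.2 then Sum.inr (e1 p.1) else Sum.inl (e0 p.1), by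
        rintro ⟨i, _ | _⟩ ⟨j, _ | _⟩ h <;> simp_all⟩
    have heL : ∀ s ∈ C I, ∀ p, s (e p) ∈ L := by
      rintro s hs ⟨i, _ | _⟩
      · exact (hs _).2 ((hr0 _).1 ⟨i, rfl⟩)
      · exact (hs _).2 ((hr1 _).1 ⟨i, rfl⟩)
    -- Both points of a pair have label `k` or `l`, so swapping them leaves the set of such
    -- positions unchanged.
    have hCinv : ∀ (ε : Fin n → Bool) (s : Fin N ⊕ Fin N' → LabeledPoint d K), s ∈ C I →
        s ∘ (pairSwap ε).viaEmbedding e ∈ C I := by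
      intro ε s hs i
      by_cases hi : i ∈ Set.range e
      · obtain ⟨p, rfl⟩ := hi
        rw [Function.comp_apply, Equiv.Perm.viaEmbedding_apply, ← hs]
        exact iff_of_true (heL s hs _) (heL s hs _)
      · rw [Function.comp_apply, Equiv.Perm.viaEmbedding_apply_of_notMem _ _ _ hi]
        exact hs i
    have hinvol : ∀ (ε : Fin n → Bool) (s : Fin N ⊕ Fin N' → LabeledPoint d K),
        (s ∘ (pairSwap ε).viaEmbedding e) ∘ (pairSwap ε).viaEmbedding e = s := by
      intro ε s
      ext1 i
      by_cases hi : i ∈ Set.range e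
      · obtain ⟨p, rfl⟩ := hi
        simp [Equiv.Perm.viaEmbedding_apply, pairSwap]
      · simp [Equiv.Perm.viaEmbedding_apply_of_notMem _ _ _ hi]
    have key := measure_inter_le_of_pairSwap D e (hCmeas I)
      (fun ε s => ⟨fun hs => by simpa only [hinvol] using hCinv ε _ hs, hCinv ε s⟩)
      (H := {q | MostlySeparated b ((1 - ρ) * n) (fun i j => signedInput k (q i j))})
      (by
        have : Measurable fun (q : Fin n → Bool → LabeledPoint d K) (i : Fin n) (j : Bool) =>
            signedInput k (q i j) :=
          measurable_pi_lambda _ fun i => measurable_pi_lambda _ fun j =>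
            (measurable_signedInput k).comp (by fun_prop)
        exact this (isOpen_setOf_mostlySeparated n b _).measurableSet)
      (4 / (n : ℝ) ^ 2) (by
        filter_upwards [hRP] with s hs
        refine card_mostlySeparated_le hn hR0 (fun i j => signedInput k (s (e (i, j))))
          (fun i j => (norm_signedInput k _).trans_le (hs _)) h _ fun ε hε => ?_
        simpa using hε)
    refine (measure_mono ?_).trans key
    rintro s ⟨hs, u, hu, hu0, hu1⟩
    refine ⟨hs, u, hu, ?_, ?_⟩
    · rwa [sampleCount_marginPoints (s ∘ Sum.inl) k l u e0 fun i => (hs (Sum.inl i)).trans (hr0 i).symm] at hu0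
    · rwa [sampleCount_marginPoints (s ∘ Sum.inr) k l (-u) e1
        fun i => (hs (Sum.inr i)).trans (hr1 i).symm] at hu1
  rw [hE, Set.iUnion₂_inter, measure_biUnion_finset hCdisj fun I _ => hCmeas I, Finset.mul_sum]
  exact (measure_biUnion_finset_le _ _).trans (Finset.sum_le_sum hmain)

/-! ### Margins, adversarial directions and the geometry of two weight differences. -/

theorem measurable_sampleCount {N : ℕ} {A : Set (LabeledPoint d K)} (hA : MeasurableSet A) :
    Measurable fun s : Fin N → LabeledPoint d K => sampleCount s A := by
  classical
  have : (fun s : Fin N → LabeledPoint d K => sampleCount s A) =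
      fun s => ∑ i, if s i ∈ A then 1 else 0 := by
    funext s
    rw [sampleCount, Set.ncard_eq_toFinset_card', Set.toFinset_ofPred, Finset.card_filter]
  rw [this]
  refine Finset.measurable_sum _ fun i _ => ?_
  exact Measurable.ite (measurable_pi_apply (X := fun _ => LabeledPoint d K) i hA)
    measurable_const measurable_const

theorem sampleCount_mono {N : ℕ} (s : Fin N → LabeledPoint d K) {A A' : Set (LabeledPoint d K)}
    (h : A ⊆ A') : sampleCount s A ≤ sampleCount s A' :=
  Set.ncard_le_ncard (fun _ hi => h hi) (Set.toFinite _)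

/-- Correct classification fixes the sign of the score difference, so the absolute value can be
dropped. -/
theorem confidentPoints_subset_marginPoints {g : (Fin K → ℝ) → Fin K} (hg : IsArgmaxRule g)
    (W : Fin K → EuclideanSpace ℝ (Fin d)) (k l : Fin K) :
    confidentPoints g W k l ⊆ marginPoints (W k - W l) k l := by
  rintro p ⟨hp, hcl, hm⟩
  refine ⟨hp, ?_⟩
  have hmax : ∀ i, inner ℝ (W i) p.1 ≤ inner ℝ (W p.2) p.1 := fun i => by
    have := hg (fun i => inner ℝ (W i) p.1) i
    rwa [show g (fun i => inner ℝ (W i) p.1) = p.2 from hcl] at this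
  by_cases hk : p.2 = k
  · rw [signedInput, if_pos hk, inner_sub_left]
    have := hmax l
    rw [hk] at this
    rwa [abs_of_nonneg (by linarith)] at hm
  · have hl : p.2 = l := hp.2.resolve_left hk
    rw [signedInput, if_neg hk, inner_neg_right, inner_sub_left]
    have := hmax k
    rw [hl] at this
    rwa [abs_of_nonpos (by linarith)] at hm

theorem isAdversarialDirection_of_inner_neg {g : (Fin K → ℝ) → Fin K} (hg : IsArgmaxRule g)
    (W : Fin K → EuclideanSpace ℝ (Fin d)) {a b : Fin K} {v x : EuclideanSpace ℝ (Fin d)}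
    (hv : inner ℝ (W a - W b) v < 0) (hx : linearClassifier g W x = a) :
    IsAdversarialDirection (linearClassifier g W) v x a := by
  set q : ℝ := inner ℝ (W a - W b) v with hq
  have hq' : 0 < -q := neg_pos.2 hv
  -- This step length brings the score gap between `a` and `b` to at most `-1`, so tie-breaking is
  -- irrelevant.
  refine ⟨hx, (|inner ℝ (W a - W b) x| + 1) / (-q), by positivity, fun h => ?_⟩
  set c := (|inner ℝ (W a - W b) x| + 1) / (-q) with hc
  have h1 := hg (fun i => inner ℝ (W i) (x + c • v)) b
  rw [show g (fun i => inner ℝ (W i) (x + c • v)) = a from h] at h1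
  have h2 : 0 ≤ inner ℝ (W a - W b) (x + c • v) := by
    rw [inner_sub_left]
    linarith
  rw [inner_add_right, inner_smul_right, ← hq] at h2
  have h3 : c * q = -(|inner ℝ (W a - W b) x| + 1) := by
    rw [hc, div_neg, neg_mul, div_mul_cancel₀ _ hv.ne]
  linarith [le_abs_self (inner ℝ (W a - W b) x : ℝ)]

/-- The bisector `‖u'‖ • u + ‖u‖ • u'` has inner products with `u`, `u'` that are positive multiples
of `‖u‖ * ‖u'‖ + ⟪u, u'⟫`. This vanishes only in the equality case of Cauchy–Schwarz for `-u`, `u'`.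
-/
theorem exists_inner_pos_or_opposite {E : Type*} [NormedAddCommGroup E] [InnerProductSpace ℝ E]
    {u u' : E} (hu : u ≠ 0) (hu' : u' ≠ 0) :
    (∃ v, 0 < inner ℝ u v ∧ 0 < inner ℝ u' v) ∨ ‖u'‖ • -u = ‖u‖ • u' := by
  by_cases h : inner ℝ (-u) u' = ‖-u‖ * ‖u'‖
  · right
    simpa using inner_eq_norm_mul_iff_real.1 h
  · left
    have h1 : 0 < ‖u‖ * ‖u'‖ + inner ℝ u u' := by
      have h2 := lt_of_le_of_ne (real_inner_le_norm (-u) u') h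
      rw [inner_neg_left, norm_neg] at h2
      linarith
    have hn := norm_pos_iff.2 hu
    have hn' := norm_pos_iff.2 hu'
    refine ⟨‖u'‖ • u + ‖u‖ • u', ?_, ?_⟩
    · rw [inner_add_right, inner_smul_right, inner_smul_right, real_inner_self_eq_norm_sq]
      nlinarith [mul_pos hn h1]
    · rw [inner_add_right, inner_smul_right, inner_smul_right, real_inner_self_eq_norm_sq,
        real_inner_comm]
      nlinarith [mul_pos hn' h1]

theorem marginPoints_subset_of_opposite {u u' : EuclideanSpace ℝ (Fin d)} (hu' : u' ≠ 0)
    (h : ‖u'‖ • -u = ‖u‖ • u') (hle : ‖u'‖ ≤ ‖u‖) (k l : Fin K) :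
    marginPoints u' k l ⊆ marginPoints (-u) k l := by
  rintro p ⟨hp, hm⟩
  refine ⟨hp, ?_⟩
  have h1 : ‖u'‖ * inner ℝ (-u) (signedInput k p) = ‖u‖ * inner ℝ u' (signedInput k p) := by
    rw [← real_inner_smul_left, h, real_inner_smul_left]
  have hn' := norm_pos_iff.2 hu'
  have h2 : ‖u'‖ * 1 < ‖u'‖ * inner ℝ (-u) (signedInput k p) := by
    rw [h1]
    nlinarith
  exact lt_of_mul_lt_mul_left h2 hn'.le

/-- A zero vector has no margin points, so `hc` makes both vectors nonzero. Were they opposite, the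
longer one would witness `OpposedSamples`, since lengthening a vector keeps its margin points. -/
theorem exists_inner_pos_of_not_opposedSamples {N N' : ℕ} {s : Fin N → LabeledPoint d K}
    {s' : Fin N' → LabeledPoint d K} {k l : Fin K} {b c : ℝ} (hc : 0 < c)
    {u u' : EuclideanSpace ℝ (Fin d)} (hub : ‖u‖ ≤ b) (hub' : ‖u'‖ ≤ b)
    (hu : c ≤ sampleCount s (marginPoints u k l)) (hu' : c ≤ sampleCount s' (marginPoints u' k l))
    (h : ¬ OpposedSamples s s' k l b c) : ∃ v, 0 < inner ℝ u v ∧ 0 < inner ℝ u' v := by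
  have h0 : ∀ {M : ℕ} (t : Fin M → LabeledPoint d K) (w : EuclideanSpace ℝ (Fin d)),
      c ≤ sampleCount t (marginPoints w k l) → w ≠ 0 := by
    rintro M t w hw rfl
    have : marginPoints (0 : EuclideanSpace ℝ (Fin d)) k l = ∅ := by
      ext p
      simp only [marginPoints, inner_zero_left, Set.mem_ofPred_eq, Set.mem_empty_iff_false,
        iff_false, not_and, not_lt]
      exact fun _ => zero_le_one
    rw [this] at hw
    simp only [sampleCount, Set.mem_empty_iff_false, Set.ofPred_false, Set.ncard_empty,
      Nat.cast_zero] at hw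
    linarith
  have hne := h0 s u hu
  have hne' := h0 s' u' hu'
  refine (exists_inner_pos_or_opposite hne hne').resolve_right fun hop => h ?_
  rcases le_total ‖u'‖ ‖u‖ with hle | hle
  · refine ⟨u, hub, hu, hu'.trans ?_⟩
    exact_mod_cast sampleCount_mono s' (marginPoints_subset_of_opposite hne' hop hle k l)
  · refine ⟨-u', by rwa [norm_neg], hu.trans ?_, by rwa [neg_neg]⟩
    have hop' : ‖u‖ • -u' = ‖u'‖ • u := by
      rw [smul_neg, ← hop, smul_neg, neg_neg]
    exact_mod_cast sampleCount_mono s (marginPoints_subset_of_opposite hne hop' hle k l)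

/-! ### Joint law of the samples and the main theorem. -/

theorem map_sumElim_eq_pi {Ω Z : Type*} [MeasurableSpace Ω] [MeasurableSpace Z] {μ : Measure Ω}
    [IsProbabilityMeasure μ] (D : Measure Z) [IsProbabilityMeasure D] {N N' : ℕ}
    {X : Ω → Fin N → Z} {X' : Ω → Fin N' → Z} (hX : Measurable X) (hX' : Measurable X')
    (hlaw : μ.map X = Measure.pi fun _ => D) (hlaw' : μ.map X' = Measure.pi fun _ => D)
    (h : IndepFun X X' μ) :
    μ.map (fun ω => Sum.elim (X ω) (X' ω)) = Measure.pi fun _ : Fin N ⊕ Fin N' => D := by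
  have h1 := h.map_prod_eq_prod_map_map hX.aemeasurable hX'.aemeasurable
  rw [hlaw, hlaw'] at h1
  have h2 := (measurePreserving_sumPiEquivProdPi_symm
    (X := fun _ : Fin N ⊕ Fin N' => Z) fun _ => D).map_eq
  rw [← h1, Measure.map_map (MeasurableEquiv.measurable _) (hX.prodMk hX')] at h2
  rw [← h2]
  rfl

end LinearClassifiers

theorem mainTheorem5
    {d K : ℕ} {Ω : Type*} [MeasurableSpace Ω] (μ : Measure Ω) [IsProbabilityMeasure μ]
    -- the data distribution, supported in the ball of radius `R`
    (D : Measure (LabeledPoint d K)) [IsProbabilityMeasure D]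
    (R B ρ : ℝ) (hρ : ρ ∈ Set.Ico (0 : ℝ) 1)
    (hR : ∀ᵐ p ∂D, ‖p.1‖ ≤ R)
    -- the argmax map used by the classifiers
    (g : (Fin K → ℝ) → Fin K) (hg : IsArgmaxRule g)
    -- the two training sets: i.i.d. samples from `D`, of sizes `N 0` and `N 1`
    (N : Fin 2 → ℕ) (X : (j : Fin 2) → Ω → Fin (N j) → LabeledPoint d K)
    (hX : ∀ j, Measurable (X j))
    (hXlaw : ∀ j, μ.map (X j) = Measure.pi (fun _ : Fin (N j) => D))
    -- the two trained weight matrices, given by their rows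
    (W : Fin 2 → Ω → Fin K → EuclideanSpace ℝ (Fin d)) (hW : ∀ j, Measurable (W j))
    -- the rows are bounded
    (hB : ∀ j, ∀ᵐ ω ∂μ, ∀ i, ‖W j ω i‖ ≤ B)
    -- each sample, together with the weights trained on it, is independent of the other sample
    (hindep : ∀ j j' : Fin 2, j ≠ j' → IndepFun (fun ω => (X j ω, W j ω)) (X j') μ)
    (k l : Fin K) (n : ℕ) (hn : 1 ≤ n)
    -- both samples have exactly `n` points labelled `k` or `l`; we condition on this event
    (hE : μ (equalCountEvent X k l n) ≠ 0)
    -- a `1 - ρ` fraction of these points is classified correctly and confidently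
    (hconf : ∀ j, ∀ᵐ ω ∂μ[|equalCountEvent X k l n],
      (1 - ρ) * (sampleCount (X j ω) (withLabels Set.univ k l) : ℝ) ≤
        (sampleCount (X j ω) (confidentPoints g (W j ω) k l) : ℝ)) :
    ∃ A : Set Ω, MeasurableSet A ∧
      1 - 4 / (n : ℝ) ^ 2 ≤ (μ[|equalCountEvent X k l n]).real A ∧
      ∀ ω ∈ A, ∃ (v : EuclideanSpace ℝ (Fin d)) (S : Set (LabeledPoint d K)),
        S ⊆ withLabels (Set.range (X 0 ω)) k l ∪ withLabels (Set.range (X 1 ω)) k l ∧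
        ∀ j : Fin 2,
          (1 - 2 * ρ) * (n : ℝ) - 4 * B * R * √(n : ℝ) - 4 * √((n : ℝ) * Real.log (n : ℝ)) ≤
            (sampleCount (X j ω) S : ℝ) ∧
          ∀ p ∈ S, linearClassifier g (W j ω) p.1 = p.2 →
            (p.2 = k → IsAdversarialDirection (linearClassifier g (W j ω)) (-v) p.1 p.2) ∧
            (p.2 = l → IsAdversarialDirection (linearClassifier g (W j ω)) v p.1 p.2) := by
  have hn' : (1 : ℝ) ≤ n := by exact_mod_cast hn
  set ν := μ[|equalCountEvent X k l n] with hν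
  have hνp : IsProbabilityMeasure ν := cond_isProbabilityMeasure hE
  -- `2 * B` bounds the row differences. If the inequality fails, the count required in (a) is
  -- negative and `S = ∅` works.
  by_cases hpos : 2 * (2 * B) * R * √n + 4 * √(n * Real.log n) ≤ (1 - 2 * ρ) * n
  swap
  · refine ⟨Set.univ, MeasurableSet.univ, ?_, fun ω _ => ⟨0, ∅, Set.empty_subset _, fun j =>
      ⟨?_, fun p hp => absurd hp (Set.notMem_empty p)⟩⟩⟩
    · rw [probReal_univ]
      have : 0 ≤ 4 / (n : ℝ) ^ 2 := by positivity
      linarith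
    · have : (0 : ℝ) ≤ sampleCount (X j ω) ∅ := Nat.cast_nonneg _
      linarith
  have hB0 : 0 ≤ B := by
    obtain ⟨ω, hω⟩ := (hB 0).exists
    exact (norm_nonneg _).trans (hω k)
  have hR0 : 0 ≤ R := by
    obtain ⟨p, hp⟩ := hR.exists
    exact (norm_nonneg _).trans hp
  set L : Set (LabeledPoint d K) := withLabels Set.univ k l
  set Z : Ω → Fin (N 0) ⊕ Fin (N 1) → LabeledPoint d K := fun ω => Sum.elim (X 0 ω) (X 1 ω) with hZ
  have hLm : ∀ j, Measurable fun ω => sampleCount (X j ω) L := fun j =>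
    (measurable_sampleCount (measurableSet_withLabels_univ k l)).comp (hX j)
  have hEm : MeasurableSet (equalCountEvent X k l n) := by
    have : equalCountEvent X k l n = ⋂ j, {ω | sampleCount (X j ω) L = n} := by
      ext ω; simp [equalCountEvent, L]
    rw [this]
    exact MeasurableSet.iInter fun j => hLm j (MeasurableSet.singleton n)
  have hZm : Measurable Z := by
    refine measurable_pi_lambda _ ?_
    rintro (i | i)
    · exact (measurable_pi_apply i).comp (hX 0)
    · exact (measurable_pi_apply i).comp (hX 1)
  have hZlaw : μ.map Z = Measure.pi fun _ => D :=
    map_sumElim_eq_pi D (hX 0) (hX 1) (hXlaw 0) (hXlaw 1)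
      ((hindep 0 1 (by decide)).comp measurable_fst measurable_id)
  -- This event involves the samples alone: `u` ranges over a whole ball, so the training procedure
  -- plays no role.
  set bad : Set Ω := {ω | OpposedSamples (X 0 ω) (X 1 ω) k l (2 * B) ((1 - ρ) * n)}
  have hbad : ν bad ≤ ENNReal.ofReal (4 / (n : ℝ) ^ 2) := by
    have h1 := measure_opposedSamples_le D hR (N 0) (N 1) k l hn hpos
    set G : Set (Fin (N 0) ⊕ Fin (N 1) → LabeledPoint d K) :=
      {s | sampleCount (s ∘ Sum.inl) L = n ∧ sampleCount (s ∘ Sum.inr) L = n}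
    have hG : Z ⁻¹' G = equalCountEvent X k l n := by
      ext ω
      simp only [Set.mem_preimage, Set.mem_ofPred_eq, equalCountEvent, Fin.forall_fin_two, G, hZ,
        Sum.elim_comp_inl, Sum.elim_comp_inr, L]
    have hGm : MeasurableSet G := by
      have hm := measurable_sampleCount (d := d) (N := N 0) (measurableSet_withLabels_univ k l)
      have hm' := measurable_sampleCount (d := d) (N := N 1) (measurableSet_withLabels_univ k l)
      exact ((hm.comp (by fun_prop : Measurable fun s : Fin (N 0) ⊕ Fin (N 1) →
          LabeledPoint d K => s ∘ Sum.inl)) (MeasurableSet.singleton n)).inter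
        ((hm'.comp (by fun_prop : Measurable fun s : Fin (N 0) ⊕ Fin (N 1) →
          LabeledPoint d K => s ∘ Sum.inr)) (MeasurableSet.singleton n))
    rw [← hZlaw, Measure.map_apply hZm hGm, hG] at h1
    have h2 := (Measure.le_map_apply hZm.aemeasurable _).trans h1
    rw [Set.preimage_inter, hG] at h2
    rw [hν, cond_apply hEm]
    calc _ ≤ (μ (equalCountEvent X k l n))⁻¹ *
          (ENNReal.ofReal (4 / (n : ℝ) ^ 2) * μ (equalCountEvent X k l n)) := by
          gcongr
          exact h2
      _ = _ := by
          rw [mul_comm, mul_assoc, ENNReal.mul_inv_cancel hE (measure_ne_top _ _), mul_one]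
  have hgood : ∀ᵐ ω ∂ν, ω ∈ equalCountEvent X k l n ∧ ∀ j, (∀ i, ‖W j ω i‖ ≤ B) ∧
      (1 - ρ) * (sampleCount (X j ω) L : ℝ) ≤
        (sampleCount (X j ω) (confidentPoints g (W j ω) k l) : ℝ) :=
    (ae_cond_mem hEm).and (ae_all_iff.2 fun j =>
      Filter.Eventually.and (cond_absolutelyContinuous.ae_le (hB j)) (hconf j))
  -- A measurable hull has the same measure and spares checking that the exceptional set is
  -- measurable.
  set T : Set Ω := toMeasurable ν (bad ∪ {ω | ω ∈ equalCountEvent X k l n ∧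
    ∀ j, (∀ i, ‖W j ω i‖ ≤ B) ∧ (1 - ρ) * (sampleCount (X j ω) L : ℝ) ≤
        (sampleCount (X j ω) (confidentPoints g (W j ω) k l) : ℝ)}ᶜ)
  have hTm : MeasurableSet T := measurableSet_toMeasurable _ _
  have hT : ν T ≤ ENNReal.ofReal (4 / (n : ℝ) ^ 2) := by
    rw [measure_toMeasurable]
    refine (measure_union_le _ _).trans ?_
    rw [show ν _ = 0 from hgood, add_zero]
    exact hbad
  refine ⟨Tᶜ, hTm.compl, ?_, fun ω hω => ?_⟩
  · rw [probReal_compl_eq_one_sub hTm]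
    have := ENNReal.toReal_le_of_le_ofReal (by positivity) hT
    exact sub_le_sub_left this 1
  obtain ⟨hnb, hω'⟩ := not_or.1 fun h => hω (subset_toMeasurable ν _ h)
  obtain ⟨hωE, hω2⟩ := not_not.1 hω'
  have hWn : ∀ j, ‖W j ω k - W j ω l‖ ≤ 2 * B := fun j =>
    (norm_sub_le _ _).trans (by linarith [(hω2 j).1 k, (hω2 j).1 l])
  have hcount : ∀ j, (1 - ρ) * n ≤
      (sampleCount (X j ω) (marginPoints (W j ω k - W j ω l) k l) : ℝ) := fun j => by
    have h1 := (hω2 j).2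
    rw [show sampleCount (X j ω) L = n from hωE j] at h1
    refine h1.trans ?_
    exact_mod_cast sampleCount_mono _ (confidentPoints_subset_marginPoints hg _ k l)
  obtain ⟨v, hv⟩ := exists_inner_pos_of_not_opposedSamples
    (mul_pos (sub_pos.2 hρ.2) (by linarith)) (hWn 0) (hWn 1) (hcount 0) (hcount 1) hnb
  have hv' : ∀ j, 0 < inner ℝ (W j ω k - W j ω l) v := Fin.forall_fin_two.2 hv
  -- `S` is the whole union, which contains all `n` relevant points of each sample.
  refine ⟨v, _, subset_rfl, fun j => ⟨?_, fun p _ hp => ⟨fun hpk => ?_, fun hpl => ?_⟩⟩⟩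
  · have h1 : n ≤ sampleCount (X j ω)
        (withLabels (Set.range (X 0 ω)) k l ∪ withLabels (Set.range (X 1 ω)) k l) := by
      rw [← hωE j]
      refine Set.ncard_le_ncard (fun i hi => ?_) (Set.toFinite _)
      have : ∀ j : Fin 2, ∀ i, X j ω i ∈ L → X j ω i ∈
          withLabels (Set.range (X 0 ω)) k l ∪ withLabels (Set.range (X 1 ω)) k l :=
        Fin.forall_fin_two.2 ⟨fun i hi => Or.inl ⟨⟨i, rfl⟩, hi.2⟩,
          fun i hi => Or.inr ⟨⟨i, rfl⟩, hi.2⟩⟩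
      exact this j i hi
    have h2 : (n : ℝ) ≤ sampleCount (X j ω)
        (withLabels (Set.range (X 0 ω)) k l ∪ withLabels (Set.range (X 1 ω)) k l) := by
      exact_mod_cast h1
    have h3 : 0 ≤ 4 * B * R * √n := by positivity
    have h4 : 0 ≤ 4 * √(n * Real.log n) := by positivity
    have h5 : 0 ≤ ρ * n := mul_nonneg hρ.1 (by linarith)
    linarith
  · refine isAdversarialDirection_of_inner_neg hg _ (b := l) ?_ hp
    rw [hpk, inner_neg_right]
    linarith [hv' j]
  · refine isAdversarialDirection_of_inner_neg hg _ (b := k) ?_ hp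
    rw [hpl, ← neg_sub, inner_neg_left]
    linarith [hv' j]
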